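/- Let $\Gamma$ be a bipartite distance-regular graph with vertex set $X$, path-length distance $\partial$, diameter $D\ge 4$, valency $k\ge 3$, and intersection numbers $b_i=|\{z\in X:\partial(x,z)=1,\ \partial(z,y)=i+1\}|$ (for any $x,y\in X$ with $\partial(x,y)=i$). Let $A$ be the adjacency matrix and $A_2$ the distance-2 matrix of $\Gamma$. Let $\theta_0>\theta_1>\cdots>\theta_D$ be the distinct eigenvalues of $A$, let $E_i$ be the primitive idempotent of $A$ associated with $\theta_i$ (the matrix of the orthogonal projection of $V=\mathbb C^X$, with its Hermitian inner product, onto the $\theta_i$-eigenspace of $A$), and let $m_i=\operatorname{rank}E_i$. Fix $x\in X$; for $0\le i\le D$ let $E_i^*$ be the diagonal matrix whose $(y,y)$-entry is $1$ if $\partial(x,y)=i$ and $0$ otherwise, and let $T$ be the subalgebra of $\mathrm{Mat}_X(\mathbb C)$ generated by $A,E_0^*,\dots,E_D^*$. A $T$-module is a $T$-invariant subspace $W\subseteq V$; it is irreducible if $W\ne 0$ and its only $T$-submodules are $0$ and $W$; an irreducible $W$ is thin if $\dim E_i^*W\le 1$ for $0\le i\le D$; its endpoint is $\min\{i: E_i^*W\neq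 0\}$. If $W$ is thin irreducible with endpoint $2$, then its local eigenvalue is the eigenvalue of $E_2^*A_2E_2^*$ on the one-dimensional space $E_2^*W$. Let $n\in\{1,\lfloor D/2\rfloor\}$ if $D$ is odd, and $n=1$ if $D$ is even. Let $W$ be a thin irreducible $T$-module with endpoint $2$ and local eigenvalue $$\tilde\theta_n=-1-\frac{b_2b_3}{\theta_n^2-b_2},$$ and let $v$ be a nonzero vector in $E_2^*W$. Then the vectors $E_iv$ $(1\le i\le D-1,\ i\ne n,\ i\ne D-n)$ are mutually orthogonal, and for each such $i$ $$\|E_iv\|^2=\frac{m_i(\theta_i^2-k^2)(\theta_i^2-\theta_n^2)}{|X|\,k\,b_1(\theta_n^2-b_2)}\,\|v\|^2,$$ where the denominator $|X|\,k\,b_1(\theta_n^2-b_2)$ is nonzero. -/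

import Mathlib

namespace DRG

/-- A finite graph is distance-regular if it is connected and, for all `h i j`, the number of
vertices `z` with `∂(x,z) = i` and `∂(z,y) = j` is the same for all vertices `x y` with
`∂(x,y) = h`. -/
structure IsDistanceRegular {X : Type*} [Fintype X] (G : SimpleGraph X) : Prop where
  connected : G.Connected
  card_eq : ∀ (h i j : ℕ) (x y x' y' : X), G.dist x y = h → G.dist x' y' = h →
    (Finset.univ.filter fun z : X => G.dist x z = i ∧ G.dist z y = j).card =
      (Finset.univ.filter fun z : X => G.dist x' z = i ∧ G.dist z y' = j).card

open Classical in
/-- The intersection number `p^h_{ij}` of a distance-regular graph: the number of `z` with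
`∂(x,z) = i` and `∂(z,y) = j`, where `x y` is any pair of vertices at distance `h`
(and `0` if there is no such pair, i.e. if `h` exceeds the diameter). -/
noncomputable def intersectionNumber {X : Type*} [Fintype X] (G : SimpleGraph X)
    (h i j : ℕ) : ℕ :=
  if H : ∃ q : X × X, G.dist q.1 q.2 = h then
    (Finset.univ.filter fun z : X => G.dist H.choose.1 z = i ∧ G.dist z H.choose.2 = j).card
  else 0

theorem IsDistanceRegular.card_eq_intersectionNumber {X : Type*} [Fintype X]
    {G : SimpleGraph X} (hG : IsDistanceRegular G) (i j : ℕ) (x y : X) :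
    (Finset.univ.filter fun z : X => G.dist x z = i ∧ G.dist z y = j).card =
      intersectionNumber G (G.dist x y) i j := by
  have H : ∃ q : X × X, G.dist q.1 q.2 = G.dist x y := ⟨(x, y), rfl⟩
  unfold intersectionNumber
  rw [dif_pos H]
  exact hG.card_eq (G.dist x y) i j x y _ _ rfl H.choose_spec

/-- The intersection number `b_i = p^i_{1,i+1}`. -/
noncomputable def b {X : Type*} [Fintype X] (G : SimpleGraph X) (i : ℕ) : ℕ :=
  intersectionNumber G i 1 (i + 1)

/-- The valency `k = b_0` of a distance-regular graph. -/
noncomputable def valency {X : Type*} [Fintype X] (G : SimpleGraph X) : ℕ := b G 0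

/-- The `i`-th distance matrix `A_i`. -/
noncomputable def distanceMatrix {X : Type*} (G : SimpleGraph X) (i : ℕ) : Matrix X X ℂ :=
  Matrix.of fun x y => if G.dist x y = i then 1 else 0

/-- The adjacency matrix `A = A_1`. -/
noncomputable def adjacencyMatrix {X : Type*} (G : SimpleGraph X) : Matrix X X ℂ :=
  distanceMatrix G 1

theorem adjacencyMatrix_eq_adjMatrix {X : Type*} (G : SimpleGraph X) [DecidableRel G.Adj] :
    adjacencyMatrix G = G.adjMatrix ℂ := by
  ext x y
  simp [adjacencyMatrix, distanceMatrix, SimpleGraph.adjMatrix_apply,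
    SimpleGraph.dist_eq_one_iff_adj]

/-- The action of a matrix on the standard module `V = ℂ^X`, which carries the Hermitian
inner product. -/
noncomputable def act {X : Type*} [Fintype X] [DecidableEq X] (B : Matrix X X ℂ) :
    EuclideanSpace ℂ X →ₗ[ℂ] EuclideanSpace ℂ X :=
  Matrix.toEuclideanLin B

/-- The eigenvalue `θ_i`: the `i`-th entry (counted from `0`) of the list of distinct
eigenvalues of the adjacency matrix in decreasing order. A distance-regular graph of
diameter `D` has exactly `D + 1` distinct eigenvalues, all real, so the default value is never
reached for `i ≤ D`. -/
noncomputable def eigenvalue {X : Type*} [Fintype X] [DecidableEq X] (G : SimpleGraph X)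
    (i : ℕ) : ℝ :=
  ((Matrix.finite_real_spectrum (A := adjacencyMatrix G)).toFinset.sort (· ≥ ·)).getD i 0

/-- The primitive idempotent `E_i` associated with `θ_i`: the matrix of the orthogonal
projection of `V` onto the eigenspace of the adjacency matrix for `θ_i`. -/
noncomputable def primitiveIdempotent {X : Type*} [Fintype X] [DecidableEq X]
    (G : SimpleGraph X) (i : ℕ) : Matrix X X ℂ :=
  Matrix.toEuclideanLin.symm
    (Module.End.eigenspace (act (adjacencyMatrix G)) (eigenvalue G i : ℂ)).starProjection

/-- The multiplicity `m_i`, the rank of `E_i`. -/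
noncomputable def multiplicity {X : Type*} [Fintype X] [DecidableEq X] (G : SimpleGraph X)
    (i : ℕ) : ℕ :=
  (primitiveIdempotent G i).rank

/-- The `i`-th dual idempotent `E*_i` with respect to the base vertex `x`. -/
noncomputable def dualIdempotent {X : Type*} [DecidableEq X] (G : SimpleGraph X) (x : X)
    (i : ℕ) : Matrix X X ℂ :=
  Matrix.diagonal fun y => if G.dist x y = i then 1 else 0

/-- The Bose-Mesner algebra `M`, generated by the adjacency matrix. -/
noncomputable def boseMesnerAlgebra {X : Type*} [Fintype X] [DecidableEq X]
    (G : SimpleGraph X) : Subalgebra ℂ (Matrix X X ℂ) :=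
  Algebra.adjoin ℂ {adjacencyMatrix G}

/-- The dual Bose-Mesner algebra `M*` with respect to `x`, generated by the `E*_i`. -/
noncomputable def dualBoseMesnerAlgebra {X : Type*} [Fintype X] [DecidableEq X]
    (G : SimpleGraph X) (x : X) : Subalgebra ℂ (Matrix X X ℂ) :=
  Algebra.adjoin ℂ (Set.range (dualIdempotent G x))

/-- The subconstituent (Terwilliger) algebra `T = T(x)`, generated by `M` and `M*`. -/
noncomputable def subconstituentAlgebra {X : Type*} [Fintype X] [DecidableEq X]
    (G : SimpleGraph X) (x : X) : Subalgebra ℂ (Matrix X X ℂ) :=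
  boseMesnerAlgebra G ⊔ dualBoseMesnerAlgebra G x

/-- A `T`-module: a subspace of `V` invariant under `T`. -/
def IsTModule {X : Type*} [Fintype X] [DecidableEq X] (G : SimpleGraph X) (x : X)
    (W : Submodule ℂ (EuclideanSpace ℂ X)) : Prop :=
  ∀ B ∈ subconstituentAlgebra G x, ∀ w ∈ W, act B w ∈ W

/-- An irreducible `T`-module: nonzero, with no `T`-modules inside other than `0` and itself. -/
structure IsIrreducibleTModule {X : Type*} [Fintype X] [DecidableEq X] (G : SimpleGraph X)
    (x : X) (W : Submodule ℂ (EuclideanSpace ℂ X)) : Prop where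
  isTModule : IsTModule G x W
  ne_bot : W ≠ ⊥
  eq_bot_or_eq : ∀ W' : Submodule ℂ (EuclideanSpace ℂ X), IsTModule G x W' → W' ≤ W →
    W' = ⊥ ∨ W' = W

/-- The subspace `E*_i W`. -/
noncomputable def dualComponent {X : Type*} [Fintype X] [DecidableEq X] (G : SimpleGraph X)
    (x : X) (i : ℕ) (W : Submodule ℂ (EuclideanSpace ℂ X)) :
    Submodule ℂ (EuclideanSpace ℂ X) :=
  W.map (act (dualIdempotent G x i))

/-- `W` is thin: `dim E*_i W ≤ 1` for `0 ≤ i ≤ D`. -/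
def IsThin {X : Type*} [Fintype X] [DecidableEq X] (G : SimpleGraph X) (x : X)
    (W : Submodule ℂ (EuclideanSpace ℂ X)) : Prop :=
  ∀ i ≤ G.diam, Module.finrank ℂ (dualComponent G x i W) ≤ 1

/-- The endpoint of `W`: the least `i` with `0 ≤ i ≤ D` and `E*_i W ≠ 0`. -/
noncomputable def endpoint {X : Type*} [Fintype X] [DecidableEq X] (G : SimpleGraph X)
    (x : X) (W : Submodule ℂ (EuclideanSpace ℂ X)) : ℕ :=
  sInf {i : ℕ | i ≤ G.diam ∧ dualComponent G x i W ≠ ⊥}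

/-- `η` is the local eigenvalue of `W`, a thin irreducible `T`-module with endpoint 2:
`E*_2 A_2 E*_2` acts on the one-dimensional space `E*_2 W` as `η`. -/
def HasLocalEigenvalue {X : Type*} [Fintype X] [DecidableEq X] (G : SimpleGraph X) (x : X)
    (W : Submodule ℂ (EuclideanSpace ℂ X)) (η : ℝ) : Prop :=
  ∀ w ∈ dualComponent G x 2 W,
    act (dualIdempotent G x 2 * distanceMatrix G 2 * dualIdempotent G x 2) w = (η : ℂ) • w

/-- `z̃ = -1 - b_2 b_3 / (z² - b_2)`, for real `z` with `z² ≠ b_2`. -/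
noncomputable def tilde {X : Type*} [Fintype X] (G : SimpleGraph X) (z : ℝ) : ℝ :=
  -1 - (b G 2 : ℝ) * b G 3 / (z ^ 2 - b G 2)

end DRG


/-!
The idempotent `E` of an eigenvalue `θ` lies in the Bose-Mesner algebra, so `E y z = q (∂(y,z))`
where `q` satisfies the three-term recurrence of the intersection numbers. Two vertices of
`Γ_2(x)` are at distance 0, 2 or 4. So if `v` is supported on `Γ_2(x)`, is orthogonal to the
all-ones vector, and is an eigenvector of `E*_2 A_2 E*_2` for `η`, then
`‖E v‖² = ⟨v, E v⟩ = (q_0 + η q_2 - (1 + η) q_4) ‖v‖²`. The recurrence expresses `q_2` and `q_4`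
through `q_0 = rank E / |X|`, and for `η` of the form `-1 - b_2 b_3 / (τ² - b_2)` the result
factors with a factor `θ² - τ²`. The two test vectors `e_u - e_w`, with `∂(u,w) = 4`, and
`e_u - e_y + e_w`, with `y` halfway between them, give `b_2 < θ_1²` and, for odd `D`,
`θ_{⌊D/2⌋}² < b_2`, which makes the denominator nonzero.
-/

namespace DRG

section Distance

variable {X : Type*} {G : SimpleGraph X}

theorem exists_geodesic (hG : G.Connected) :
    ∃ γ : ℕ → X, ∀ i j, i ≤ j → j ≤ G.diam → G.dist (γ i) (γ j) = j - i := by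
  have := hG.nonempty
  obtain ⟨u, v, huv⟩ := G.exists_dist_eq_diam
  obtain ⟨p, hp⟩ := hG.exists_walk_length_eq_dist u v
  have hstep : ∀ j < G.diam, G.dist (p.getVert j) (p.getVert (j + 1)) = 1 := fun j hj =>
    SimpleGraph.dist_eq_one_iff_adj.mpr (p.adj_getVert_succ (by omega))
  have hle : ∀ i j, i ≤ j → j ≤ G.diam → G.dist (p.getVert i) (p.getVert j) ≤ j - i := by
    intro i j hij
    induction j, hij using Nat.le_induction with
    | base => simp
    | succ j hij ih =>
      intro hj
      have htri := hG.dist_triangle (u := p.getVert i) (v := p.getVert j) (w := p.getVert (j + 1))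
      have := ih (by omega)
      have := hstep j (by omega)
      omega
  refine ⟨p.getVert, fun i j hij hj => le_antisymm (hle i j hij hj) ?_⟩
  have hfirst := hle 0 i (by omega) (by omega)
  have hlast := hle j G.diam hj le_rfl
  have htri := hG.dist_triangle (u := u) (v := p.getVert i) (w := v)
  have htri' := hG.dist_triangle (u := p.getVert i) (v := p.getVert j) (w := v)
  rw [p.getVert_zero] at hfirst
  rw [← huv, ← hp, p.getVert_length, hp] at hlast
  omega

theorem dist_le_diam_of_connected [Finite X] (hG : G.Connected) (u v : X) :
    G.dist u v ≤ G.diam := by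
  have := hG.nonempty
  exact SimpleGraph.dist_le_diam (SimpleGraph.connected_iff_ediam_ne_top.mp hG)

theorem exists_boolColoring (hbip : G.IsBipartite) : Nonempty (G.Coloring Bool) :=
  Nonempty.map (SimpleGraph.recolorOfEquiv G finTwoEquiv) hbip

theorem even_dist_iff (hG : G.Connected) (color : G.Coloring Bool) (u v : X) :
    Even (G.dist u v) ↔ (color u ↔ color v) := by
  obtain ⟨p, hp⟩ := hG.exists_walk_length_eq_dist u v
  rw [← hp, color.even_length_iff_congr]

theorem even_dist_iff_of_even_dist (hG : G.Connected) (hbip : G.IsBipartite) {u v : X}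
    (huv : Even (G.dist u v)) (w : X) : Even (G.dist u w) ↔ Even (G.dist v w) := by
  obtain ⟨color⟩ := exists_boolColoring hbip
  rw [even_dist_iff hG color] at huv ⊢
  rw [even_dist_iff hG color, huv]

theorem dist_eq_succ_or_succ_eq_of_adj (hG : G.Connected) (hbip : G.IsBipartite) {u v : X}
    (h : G.Adj u v) (w : X) : G.dist v w + 1 = G.dist u w ∨ G.dist v w = G.dist u w + 1 := by
  obtain ⟨color⟩ := exists_boolColoring hbip
  have hne : G.dist v w ≠ G.dist u w := by
    intro heq
    have hv := even_dist_iff hG color v w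
    rw [heq, even_dist_iff hG color u w] at hv
    have := color.valid h
    grind
  have huv := SimpleGraph.dist_eq_one_iff_adj.mpr h
  have hvu := SimpleGraph.dist_eq_one_iff_adj.mpr h.symm
  have := hG.dist_triangle (u := u) (v := v) (w := w)
  have := hG.dist_triangle (u := v) (v := u) (w := w)
  omega

theorem dist_eq_zero_or_two_or_four (hG : G.Connected) (hbip : G.IsBipartite) {x y z : X}
    (hy : G.dist x y = 2) (hz : G.dist x z = 2) :
    G.dist y z = 0 ∨ G.dist y z = 2 ∨ G.dist y z = 4 := by
  have heven : Even (G.dist y z) :=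
    (even_dist_iff_of_even_dist hG hbip (hy ▸ even_two) z).mp (hz ▸ even_two)
  have htri := hG.dist_triangle (u := y) (v := x) (w := z)
  rw [G.dist_comm (u := y) (v := x), hy, hz] at htri
  obtain ⟨m, hm⟩ := heven
  omega

end Distance

section IntersectionNumbers

variable {X : Type*} [Fintype X] {G : SimpleGraph X}

/-- The intersection number `c_i = p^i_{1,i-1}`. The truncated subtraction at `i = 0` is harmless,
see `c_zero`. -/
noncomputable def c (G : SimpleGraph X) (i : ℕ) : ℕ :=
  intersectionNumber G i 1 (i - 1)

theorem intersectionNumber_pos (hG : IsDistanceRegular G) (x y z : X) :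
    0 < intersectionNumber G (G.dist x y) (G.dist x z) (G.dist z y) := by
  rw [← hG.card_eq_intersectionNumber]
  exact Finset.card_pos.mpr ⟨z, by simp⟩

theorem intersectionNumber_eq_zero (hG : G.Connected) {h i j : ℕ} (hij : i + j < h) :
    intersectionNumber G h i j = 0 := by
  unfold intersectionNumber
  split_ifs with H
  · rw [Finset.card_eq_zero, Finset.filter_eq_empty_iff]
    rintro z - ⟨hi, hj⟩
    have := hG.dist_triangle (u := H.choose.1) (v := z) (w := H.choose.2)
    have := H.choose_spec
    omega
  · rfl

theorem b_pos (hG : IsDistanceRegular G) {i : ℕ} (hi : i < G.diam) : 0 < b G i := by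
  obtain ⟨γ, hγ⟩ := exists_geodesic hG.connected
  have h := intersectionNumber_pos hG (γ 1) (γ (i + 1)) (γ 0)
  rwa [G.dist_comm (u := γ 1) (v := γ 0), hγ _ _ (by omega) (by omega),
    hγ _ _ (by omega) (by omega), hγ _ _ (by omega) (by omega)] at h

theorem c_pos (hG : IsDistanceRegular G) {i : ℕ} (hi : 1 ≤ i) (hi' : i ≤ G.diam) :
    0 < c G i := by
  obtain ⟨γ, hγ⟩ := exists_geodesic hG.connected
  have h := intersectionNumber_pos hG (γ 0) (γ i) (γ 1)
  rwa [hγ _ _ (by omega) (by omega), hγ _ _ (by omega) (by omega),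
    hγ _ _ (by omega) (by omega)] at h

theorem c_zero (hG : IsDistanceRegular G) : c G 0 = 0 := by
  obtain ⟨x⟩ := hG.connected.nonempty
  have h := hG.card_eq_intersectionNumber 1 0 x x
  rw [SimpleGraph.dist_self] at h
  rw [c, ← h, Finset.card_eq_zero, Finset.filter_eq_empty_iff]
  rintro z - ⟨h1, h0⟩
  rw [G.dist_comm] at h0
  omega

theorem c_one (hG : IsDistanceRegular G) (hD : 1 ≤ G.diam) : c G 1 = 1 := by
  obtain ⟨γ, hγ⟩ := exists_geodesic hG.connected
  have h01 := hγ 0 1 (Nat.zero_le _) hD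
  have h := hG.card_eq_intersectionNumber 1 0 (γ 0) (γ 1)
  rw [h01] at h
  rw [c, ← h, Finset.card_eq_one]
  refine ⟨γ 1, Finset.ext fun z => ?_⟩
  simp only [Finset.mem_filter, Finset.mem_univ, true_and, Finset.mem_singleton,
    hG.connected.dist_eq_zero_iff]
  exact ⟨And.right, by rintro rfl; exact ⟨h01, rfl⟩⟩

theorem distanceMatrix_mul_apply (hG : IsDistanceRegular G) (i j : ℕ) (y z : X) :
    (distanceMatrix G i * distanceMatrix G j) y z = intersectionNumber G (G.dist y z) i j := by
  rw [← hG.card_eq_intersectionNumber, ← Finset.sum_boole, Matrix.mul_apply]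
  simp only [distanceMatrix, Matrix.of_apply, ite_and, ite_mul, one_mul, zero_mul]

theorem sum_adjacencyMatrix_apply (hG : IsDistanceRegular G) (y : X) :
    ∑ z, adjacencyMatrix G y z = valency G := by
  have h := distanceMatrix_mul_apply hG 1 1 y y
  rw [Matrix.mul_apply, SimpleGraph.dist_self] at h
  refine Eq.trans (Finset.sum_congr rfl fun z _ => ?_) h
  simp only [adjacencyMatrix, distanceMatrix, Matrix.of_apply, G.dist_comm (u := z)]
  split_ifs <;> simp

theorem sum_adjacencyMatrix_mul (hG : IsDistanceRegular G) (hbip : G.IsBipartite) (f : ℕ → ℂ)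
    (y z : X) :
    ∑ w, adjacencyMatrix G y w * f (G.dist w z) =
      c G (G.dist y z) * f (G.dist y z - 1) + b G (G.dist y z) * f (G.dist y z + 1) := by
  have hsplit : ∀ w, adjacencyMatrix G y w * f (G.dist w z) =
      (if G.dist y w = 1 ∧ G.dist w z = G.dist y z - 1 then f (G.dist y z - 1) else 0) +
      (if G.dist y w = 1 ∧ G.dist w z = G.dist y z + 1 then f (G.dist y z + 1) else 0) := by
    intro w
    simp only [adjacencyMatrix, distanceMatrix, Matrix.of_apply]
    by_cases hyw : G.dist y w = 1
    · have := dist_eq_succ_or_succ_eq_of_adj hG.connected hbip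
        (SimpleGraph.dist_eq_one_iff_adj.mp hyw) z
      grind
    · simp [hyw]
  simp only [hsplit, Finset.sum_add_distrib, ← Finset.sum_filter, Finset.sum_const, nsmul_eq_mul,
    hG.card_eq_intersectionNumber]
  rfl

theorem c_add_b (hG : IsDistanceRegular G) (hbip : G.IsBipartite) {i : ℕ} (hi : i ≤ G.diam) :
    c G i + b G i = valency G := by
  obtain ⟨γ, hγ⟩ := exists_geodesic hG.connected
  have h := sum_adjacencyMatrix_mul hG hbip (fun _ => 1) (γ 0) (γ i)
  simp only [mul_one, sum_adjacencyMatrix_apply hG, hγ 0 i (Nat.zero_le _) hi,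
    Nat.sub_zero] at h
  exact_mod_cast h.symm

end IntersectionNumbers

section Eigenprojection

variable {X : Type*} [Fintype X] [DecidableEq X]

theorem act_apply (B : Matrix X X ℂ) (v : EuclideanSpace ℂ X) (y : X) :
    act B v y = ∑ z, B y z * v z := rfl

theorem act_single (B : Matrix X X ℂ) (u y : X) :
    act B (EuclideanSpace.single u 1) y = B y u := by
  simp [act_apply]

theorem act_mul (B C : Matrix X X ℂ) (v : EuclideanSpace ℂ X) :
    act (B * C) v = act B (act C v) :=
  LinearMap.congr_fun (map_mul (Matrix.toLpLinAlgEquiv 2) B C) v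

theorem act_injective : Function.Injective (act (X := X)) :=
  Matrix.toEuclideanLin.injective

theorem act_aeval {B : Matrix X X ℂ} {μ : ℂ} {v : EuclideanSpace ℂ X} (h : act B v = μ • v)
    (p : Polynomial ℂ) : act (Polynomial.aeval B p) v = p.eval μ • v := by
  have hact : act (Polynomial.aeval B p) = Polynomial.aeval (act B) p :=
    (Polynomial.aeval_algHom_apply (Matrix.toLpLinAlgEquiv (R := ℂ) (n := X) 2) B p).symm
  rw [hact]
  exact Module.End.aeval_apply_of_mem_apply_eq_smul h

theorem act_isSymmetric {B : Matrix X X ℂ} (hB : B.IsHermitian) : (act B).IsSymmetric :=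
  Matrix.isSymmetric_toEuclideanLin_iff.mpr hB

theorem act_eigenvectorBasis {B : Matrix X X ℂ} (hB : B.IsHermitian) (i : X) :
    act B (hB.eigenvectorBasis i) = (hB.eigenvalues i : ℂ) • hB.eigenvectorBasis i :=
  PiLp.ext fun y => by simpa [act] using congrFun (hB.mulVec_eigenvectorBasis i) y

theorem inner_eq_zero_of_act_eq_smul {B : Matrix X X ℂ} (hB : B.IsHermitian) {θ μ : ℝ}
    (h : θ ≠ μ) {v w : EuclideanSpace ℂ X} (hv : act B v = (θ : ℂ) • v)
    (hw : act B w = (μ : ℂ) • w) : inner ℂ v w = 0 :=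
  (act_isSymmetric hB).orthogonalFamily_eigenspaces (Complex.ofReal_injective.ne h)
    ⟨v, Module.End.mem_eigenspace_iff.mpr hv⟩ ⟨w, Module.End.mem_eigenspace_iff.mpr hw⟩

theorem norm_act_sq {B : Matrix X X ℂ} (hB : B.IsHermitian) (v : EuclideanSpace ℂ X) :
    ‖act B v‖ ^ 2 = ∑ i, hB.eigenvalues i ^ 2 * ‖inner ℂ (hB.eigenvectorBasis i) v‖ ^ 2 := by
  rw [← hB.eigenvectorBasis.sum_sq_norm_inner_right]
  refine Finset.sum_congr rfl fun i _ => ?_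
  rw [← act_isSymmetric hB, act_eigenvectorBasis, inner_smul_left, Complex.conj_ofReal, norm_mul,
    mul_pow, Complex.norm_real, Real.norm_eq_abs, sq_abs]

theorem mem_spectrum_iff_exists_act_eq_smul {B : Matrix X X ℂ} {θ : ℝ} :
    θ ∈ spectrum ℝ B ↔ ∃ v ≠ 0, act B v = (θ : ℂ) • v := by
  rw [← spectrum.algebraMap_mem_iff ℂ, ← Matrix.spectrum_toLpLin 2,
    ← Module.End.hasEigenvalue_iff_mem_spectrum]
  refine ⟨fun h => ?_, fun ⟨v, hv0, hv⟩ => ?_⟩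
  · obtain ⟨v, hv⟩ := h.exists_hasEigenvector
    exact ⟨v, hv.2, hv.apply_eq_smul⟩
  · exact Module.End.hasEigenvalue_of_hasEigenvector
      ⟨Module.End.mem_eigenspace_iff.mpr hv, hv0⟩

/-- The matrix of the orthogonal projection onto the `θ`-eigenspace of `B`; it is `0` when `θ` is
not an eigenvalue. For `B = A` and `θ = θ_i` this is the primitive idempotent `E_i`. -/
noncomputable def eigenprojection (B : Matrix X X ℂ) (θ : ℝ) : Matrix X X ℂ :=
  Matrix.toEuclideanLin.symm (Module.End.eigenspace (act B) (θ : ℂ)).starProjection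

theorem act_eigenprojection (B : Matrix X X ℂ) (θ : ℝ) :
    act (eigenprojection B θ) = (Module.End.eigenspace (act B) (θ : ℂ)).starProjection :=
  Matrix.toEuclideanLin.apply_symm_apply _

theorem act_eigenprojection_eq_self {B : Matrix X X ℂ} {θ : ℝ} {v : EuclideanSpace ℂ X}
    (hv : act B v = (θ : ℂ) • v) : act (eigenprojection B θ) v = v := by
  rw [act_eigenprojection]
  exact Submodule.starProjection_eq_self_iff.mpr (Module.End.mem_eigenspace_iff.mpr hv)

theorem act_eigenprojection_eq_zero {B : Matrix X X ℂ} (hB : B.IsHermitian) {θ μ : ℝ} (h : θ ≠ μ)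
    {v : EuclideanSpace ℂ X} (hv : act B v = (μ : ℂ) • v) : act (eigenprojection B θ) v = 0 := by
  rw [act_eigenprojection]
  exact (Submodule.starProjection_apply_eq_zero_iff _).mpr <| (Submodule.mem_orthogonal _ _).mpr
    fun u hu => inner_eq_zero_of_act_eq_smul hB h (Module.End.mem_eigenspace_iff.mp hu) hv

theorem act_act_eigenprojection (B : Matrix X X ℂ) (θ : ℝ) (v : EuclideanSpace ℂ X) :
    act B (act (eigenprojection B θ) v) = (θ : ℂ) • act (eigenprojection B θ) v := by
  rw [act_eigenprojection]
  exact Module.End.mem_eigenspace_iff.mp (Submodule.starProjection_apply_mem _ v)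

theorem mul_eigenprojection (B : Matrix X X ℂ) (θ : ℝ) :
    B * eigenprojection B θ = (θ : ℂ) • eigenprojection B θ :=
  act_injective <| LinearMap.ext fun v => by
    rw [act_mul, act_act_eigenprojection, act, act, map_smul, LinearMap.smul_apply]

theorem isIdempotentElem_eigenprojection (B : Matrix X X ℂ) (θ : ℝ) :
    IsIdempotentElem (eigenprojection B θ) :=
  act_injective <| LinearMap.ext fun v => by
    rw [act_mul, act_eigenprojection_eq_self (act_act_eigenprojection B θ v)]

theorem eigenprojection_ne_zero {B : Matrix X X ℂ} {θ : ℝ} (hθ : θ ∈ spectrum ℝ B) :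
    eigenprojection B θ ≠ 0 := by
  obtain ⟨v, hv0, hv⟩ := mem_spectrum_iff_exists_act_eq_smul.mp hθ
  intro h
  apply hv0
  rw [← act_eigenprojection_eq_self hv, h, act, map_zero, LinearMap.zero_apply]

theorem eigenprojection_mem_adjoin {B : Matrix X X ℂ} (hB : B.IsHermitian) (θ : ℝ) :
    eigenprojection B θ ∈ Algebra.adjoin ℂ {B} := by
  rw [Algebra.adjoin_singleton_eq_range_aeval]
  -- The Lagrange polynomial that is `1` at `θ` and `0` at the other eigenvalues.
  refine ⟨Lagrange.interpolate (Finset.univ.image hB.eigenvalues) (fun μ : ℝ => (μ : ℂ))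
    (fun μ => if μ = θ then 1 else 0), act_injective ?_⟩
  refine hB.eigenvectorBasis.toBasis.ext fun i => ?_
  rw [OrthonormalBasis.coe_toBasis, AlgHom.toRingHom_eq_coe, RingHom.coe_coe,
    act_aeval (act_eigenvectorBasis hB i),
    Lagrange.eval_interpolate_at_node (v := fun μ : ℝ => (μ : ℂ)) _
      Complex.ofReal_injective.injOn (Finset.mem_image_of_mem _ (Finset.mem_univ i))]
  split_ifs with h
  · rw [one_smul, act_eigenprojection_eq_self (h ▸ act_eigenvectorBasis hB i)]
  · rw [zero_smul, act_eigenprojection_eq_zero hB (Ne.symm h) (act_eigenvectorBasis hB i)]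

theorem norm_act_eigenprojection_sq (B : Matrix X X ℂ) (θ : ℝ) (v : EuclideanSpace ℂ X) :
    ((‖act (eigenprojection B θ) v‖ ^ 2 : ℝ) : ℂ) = inner ℂ v (act (eigenprojection B θ) v) := by
  set U := Module.End.eigenspace (act B) (θ : ℂ)
  have hself : inner ℂ (U.starProjection v) (U.starProjection v) =
      inner ℂ v (U.starProjection v) := by
    rw [Submodule.inner_starProjection_left_eq_right,
      Submodule.starProjection_eq_self_iff.mpr (U.starProjection_apply_mem v)]
  rw [act_eigenprojection, Complex.ofReal_pow]
  exact (inner_self_eq_norm_sq_to_K _).symm.trans hself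

theorem trace_eq_rank_of_isIdempotentElem {ι K : Type*} [Fintype ι] [Field K] {P : Matrix ι ι K}
    (hP : IsIdempotentElem P) : P.trace = P.rank := by
  classical
  have hproj := LinearMap.IsIdempotentElem.isProj_range (Matrix.toLin' P)
    (hP.map (Matrix.toLinAlgEquiv' (R := K) (n := ι)))
  rw [← Matrix.trace_toLin'_eq, hproj.trace, Matrix.rank]
  rfl

end Eigenprojection

section CosineSequence

variable {X : Type*} [Fintype X] {G : SimpleGraph X}

/-- A cosine sequence of `G` for `θ`: a solution of the three-term recurrence
`c_h q_{h-1} + b_h q_{h+1} = θ q_h` for `0 ≤ h ≤ D`. The usual normalisation `q_0 = 1` is not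
imposed, so that the entries of a primitive idempotent qualify. The truncated `h - 1` at `h = 0`
is harmless since `c_0 = 0`. -/
def IsCosineSequence (G : SimpleGraph X) (θ : ℂ) (q : ℕ → ℂ) : Prop :=
  ∀ h ≤ G.diam, c G h * q (h - 1) + b G h * q (h + 1) = θ * q h

namespace IsCosineSequence

variable {θ : ℂ} {q r : ℕ → ℂ}

theorem mul_apply_zero (hG : IsDistanceRegular G) (hq : IsCosineSequence G θ q)
    (hr : IsCosineSequence G θ r) {h : ℕ} (hh : h ≤ G.diam) : q h * r 0 = r h * q 0 := by
  induction h using Nat.strong_induction_on with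
  | _ h ih =>
    rcases h with _ | h
    · exact mul_comm _ _
    have hb : (b G h : ℂ) ≠ 0 := Nat.cast_ne_zero.mpr (b_pos hG (by omega)).ne'
    have hprev : c G h * (q (h - 1) * r 0) = c G h * (r (h - 1) * q 0) := by
      rw [ih (h - 1) (by omega) (by omega)]
    refine mul_left_cancel₀ hb ?_
    linear_combination r 0 * hq h (by omega) - q 0 * hr h (by omega) - hprev +
      θ * ih h (by omega) (by omega)

theorem pow (hG : IsDistanceRegular G) (hbip : G.IsBipartite) {s : ℂ} (hs : s ^ 2 = 1) :
    IsCosineSequence G (s * valency G) (s ^ ·) := by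
  intro h hh
  have hcb : (c G h : ℂ) + b G h = valency G := by exact_mod_cast c_add_b hG hbip hh
  rcases h with _ | h
  · rw [c_zero hG, Nat.cast_zero] at hcb ⊢
    linear_combination s * hcb
  · rw [Nat.add_sub_cancel]
    linear_combination s ^ (h + 2) * hcb - c G (h + 1) * s ^ h * hs

theorem apply_eq_apply_of_even_iff (hG : IsDistanceRegular G) (hbip : G.IsBipartite)
    (hq : IsCosineSequence G θ q) (hθ : θ ^ 2 = (valency G : ℂ) ^ 2) {h j : ℕ}
    (hh : h ≤ G.diam) (hj : j ≤ G.diam) (hhj : Even h ↔ Even j) : q h = q j := by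
  obtain ⟨s, hs, rfl⟩ : ∃ s : ℂ, (s = 1 ∨ s = -1) ∧ θ = s * valency G := by
    rcases sq_eq_sq_iff_eq_or_eq_neg.mp hθ with h | h
    · exact ⟨1, by simp [h]⟩
    · exact ⟨-1, by simp [h]⟩
  have hpow : s ^ h = s ^ j := by
    rcases hs with rfl | rfl
    · simp
    · rw [neg_one_pow_eq_ite, neg_one_pow_eq_ite]
      simp only [hhj]
  have hs2 : s ^ 2 = 1 := by rcases hs with rfl | rfl <;> norm_num
  have hform : ∀ i ≤ G.diam, q i = s ^ i * q 0 := fun i hi => by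
    simpa using hq.mul_apply_zero hG (pow hG hbip hs2) hi
  rw [hform h hh, hform j hj, hpow]

theorem apply_two (hG : IsDistanceRegular G) (hD : 1 ≤ G.diam) (hq : IsCosineSequence G θ q) :
    valency G * b G 1 * q 2 = (θ ^ 2 - valency G) * q 0 := by
  have h0 := hq 0 (Nat.zero_le _)
  have h1 := hq 1 hD
  simp only [c_zero hG, c_one hG hD, Nat.cast_zero, Nat.cast_one, Nat.sub_self, Nat.zero_sub,
    Nat.zero_add, Nat.reduceAdd] at h0 h1
  change 0 * q 0 + valency G * q 1 = θ * q 0 at h0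
  linear_combination valency G * h1 + θ * h0

theorem apply_four (hG : IsDistanceRegular G) (hD : 3 ≤ G.diam) (hq : IsCosineSequence G θ q) :
    valency G * b G 1 * b G 2 * b G 3 * q 4 =
      (θ ^ 2 * (θ ^ 2 - valency G - c G 2 * b G 1) - c G 3 * b G 2 * (θ ^ 2 - valency G)) *
        q 0 := by
  have h0 := hq 0 (Nat.zero_le _)
  have h2 := hq 2 (by omega)
  have h3 := hq 3 hD
  simp only [c_zero hG, Nat.cast_zero, Nat.zero_sub, Nat.zero_add, Nat.reduceSub,
    Nat.reduceAdd] at h0 h2 h3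
  change 0 * q 0 + valency G * q 1 = θ * q 0 at h0
  have hq2 := hq.apply_two hG (by omega)
  have hq3 : valency G * b G 1 * b G 2 * q 3 =
      θ * (θ ^ 2 - valency G - c G 2 * b G 1) * q 0 := by
    linear_combination valency G * b G 1 * h2 + θ * hq2 - c G 2 * b G 1 * h0
  linear_combination valency G * b G 1 * b G 2 * h3 + θ * hq3 - c G 3 * b G 2 * hq2

theorem apply_zero_add_apply_two_sub_apply_four (hG : IsDistanceRegular G)
    (hbip : G.IsBipartite) (hD : 3 ≤ G.diam) (hq : IsCosineSequence G θ q) (η : ℂ) :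
    valency G * b G 1 * b G 2 * b G 3 * (q 0 + η * q 2 - (1 + η) * q 4) =
      (valency G ^ 2 - θ ^ 2) * (b G 2 * b G 3 + (1 + η) * (θ ^ 2 - b G 2)) * q 0 := by
  have hq2 := hq.apply_two hG (by omega)
  have hq4 := hq.apply_four hG hD
  have hb1 : (b G 1 : ℂ) = valency G - 1 := by
    rw [← c_add_b hG hbip (i := 1) (by omega), c_one hG (by omega)]
    push_cast
    ring
  have hc2 : (c G 2 : ℂ) = valency G - b G 2 := by
    rw [← c_add_b hG hbip (i := 2) (by omega)]
    push_cast
    ring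
  have hc3 : (c G 3 : ℂ) = valency G - b G 3 := by
    rw [← c_add_b hG hbip hD]
    push_cast
    ring
  rw [hb1] at hq2
  rw [hc2, hc3, hb1] at hq4
  rw [hb1]
  linear_combination b G 2 * b G 3 * η * hq2 - (1 + η) * hq4

end IsCosineSequence

variable {B : Matrix X X ℂ} {q : ℕ → ℂ}

theorem isCosineSequence_of_adjacencyMatrix_mul (hG : IsDistanceRegular G)
    (hbip : G.IsBipartite) (hB : ∀ y z, B y z = q (G.dist y z)) {θ : ℂ}
    (hAB : adjacencyMatrix G * B = θ • B) : IsCosineSequence G θ q := by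
  intro h hh
  obtain ⟨γ, hγ⟩ := exists_geodesic hG.connected
  have hentry := congrFun₂ hAB (γ 0) (γ h)
  simp only [Matrix.mul_apply, Matrix.smul_apply, smul_eq_mul, hB] at hentry
  rwa [sum_adjacencyMatrix_mul hG hbip, hγ 0 h (Nat.zero_le _) hh] at hentry

theorem eq_sum_distanceMatrix {X : Type*} [Finite X] {G : SimpleGraph X} {B : Matrix X X ℂ}
    (hG : G.Connected) (hB : ∀ y z, B y z = q (G.dist y z)) :
    B = ∑ i ∈ Finset.range (G.diam + 1), q i • distanceMatrix G i := by
  ext y z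
  have hmem : G.dist y z < G.diam + 1 := Nat.lt_succ_of_le (dist_le_diam_of_connected hG y z)
  simp [hB, Matrix.sum_apply, distanceMatrix, hmem]

variable [DecidableEq X]

theorem exists_apply_eq_dist_of_mem_boseMesnerAlgebra (hG : IsDistanceRegular G)
    (hB : B ∈ boseMesnerAlgebra G) : ∃ q : ℕ → ℂ, ∀ y z, B y z = q (G.dist y z) := by
  induction hB using Algebra.adjoin_induction with
  | mem C hC =>
    obtain rfl := Set.mem_singleton_iff.mp hC
    exact ⟨fun h => if h = 1 then 1 else 0, fun _ _ => rfl⟩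
  | algebraMap a =>
    refine ⟨fun h => if h = 0 then a else 0, fun y z => ?_⟩
    simp [Matrix.algebraMap_matrix_apply, hG.connected.dist_eq_zero_iff]
  | add C C' _ _ hC hC' =>
    obtain ⟨f, hf⟩ := hC
    obtain ⟨g, hg⟩ := hC'
    exact ⟨f + g, fun y z => by simp [hf, hg]⟩
  | mul C C' _ _ hC hC' =>
    obtain ⟨f, hf⟩ := hC
    obtain ⟨g, hg⟩ := hC'
    refine ⟨fun h => ∑ i ∈ Finset.range (G.diam + 1), ∑ j ∈ Finset.range (G.diam + 1),
      g j * (f i * intersectionNumber G h i j), fun y z => ?_⟩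
    rw [eq_sum_distanceMatrix hG.connected hf, eq_sum_distanceMatrix hG.connected hg,
      Finset.sum_mul_sum]
    simp [Matrix.sum_apply, distanceMatrix_mul_apply hG]

theorem isHermitian_adjacencyMatrix {X : Type*} (G : SimpleGraph X) :
    (adjacencyMatrix G).IsHermitian := by
  ext y z
  simp only [Matrix.conjTranspose_apply, adjacencyMatrix, distanceMatrix, Matrix.of_apply,
    G.dist_comm (u := z)]
  split_ifs <;> simp

theorem exists_eigenprojection_apply_eq_dist (hG : IsDistanceRegular G) (θ : ℝ) :
    ∃ q : ℕ → ℂ, ∀ y z, eigenprojection (adjacencyMatrix G) θ y z = q (G.dist y z) :=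
  exists_apply_eq_dist_of_mem_boseMesnerAlgebra hG
    (eigenprojection_mem_adjoin (isHermitian_adjacencyMatrix G) θ)

theorem isCosineSequence_of_eigenprojection (hG : IsDistanceRegular G) (hbip : G.IsBipartite)
    {θ : ℝ} (hq : ∀ y z, eigenprojection (adjacencyMatrix G) θ y z = q (G.dist y z)) :
    IsCosineSequence G θ q :=
  isCosineSequence_of_adjacencyMatrix_mul hG hbip hq (mul_eigenprojection _ θ)

theorem card_mul_apply_zero_of_eigenprojection {θ : ℝ}
    (hq : ∀ y z, eigenprojection (adjacencyMatrix G) θ y z = q (G.dist y z)) :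
    Fintype.card X * q 0 = (eigenprojection (adjacencyMatrix G) θ).rank := by
  rw [← trace_eq_rank_of_isIdempotentElem (isIdempotentElem_eigenprojection _ θ), Matrix.trace]
  simp [hq]

end CosineSequence

section Spectrum

variable {X : Type*} [Fintype X] [DecidableEq X] {G : SimpleGraph X}

theorem adjacencyMatrix_pow_apply_eq_zero {i : ℕ} {y z : X} (h : i < G.dist y z) :
    (adjacencyMatrix G ^ i) y z = 0 := by
  classical
  rw [adjacencyMatrix_eq_adjMatrix, SimpleGraph.adjMatrix_pow_apply_eq_card_walk,
    Nat.cast_eq_zero, Fintype.card_eq_zero_iff]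
  exact ⟨fun ⟨w, hw⟩ => h.not_ge (hw ▸ SimpleGraph.dist_le w)⟩

theorem adjacencyMatrix_pow_dist_apply_ne_zero (hG : G.Connected) (y z : X) :
    (adjacencyMatrix G ^ G.dist y z) y z ≠ 0 := by
  classical
  rw [adjacencyMatrix_eq_adjMatrix, SimpleGraph.adjMatrix_pow_apply_eq_card_walk]
  obtain ⟨w, hw⟩ := hG.exists_walk_length_eq_dist y z
  have : Nonempty {w : G.Walk y z | w.length = G.dist y z} := ⟨⟨w, hw⟩⟩
  exact Nat.cast_ne_zero.mpr Fintype.card_ne_zero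

theorem diam_lt_natDegree_of_aeval_eq_zero (hG : G.Connected) {p : Polynomial ℂ} (hp : p.Monic)
    (hp0 : Polynomial.aeval (adjacencyMatrix G) p = 0) : G.diam < p.natDegree := by
  by_contra! hdeg
  obtain ⟨γ, hγ⟩ := exists_geodesic hG
  have hdist : G.dist (γ 0) (γ p.natDegree) = p.natDegree := hγ 0 _ (Nat.zero_le _) hdeg
  have hentry : (Polynomial.aeval (adjacencyMatrix G) p) (γ 0) (γ p.natDegree) =
      (adjacencyMatrix G ^ p.natDegree) (γ 0) (γ p.natDegree) := by
    rw [Polynomial.aeval_eq_sum_range, Matrix.sum_apply, Finset.sum_range_succ,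
      Finset.sum_eq_zero, zero_add, hp.coeff_natDegree, one_smul]
    intro i hi
    rw [Matrix.smul_apply, adjacencyMatrix_pow_apply_eq_zero
      (hdist.symm ▸ Finset.mem_range.mp hi), smul_zero]
  have hne := adjacencyMatrix_pow_dist_apply_ne_zero hG (γ 0) (γ p.natDegree)
  rw [hdist, ← hentry, hp0] at hne
  exact hne rfl

theorem aeval_prod_X_sub_C_spectrum {B : Matrix X X ℂ} (hB : B.IsHermitian) :
    Polynomial.aeval B (∏ μ ∈ (Matrix.finite_real_spectrum (A := B)).toFinset,
      (Polynomial.X - Polynomial.C (μ : ℂ))) = 0 := by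
  refine act_injective (hB.eigenvectorBasis.toBasis.ext fun i => ?_)
  have hmem : hB.eigenvalues i ∈ (Matrix.finite_real_spectrum (A := B)).toFinset :=
    (Set.Finite.mem_toFinset _).mpr (hB.eigenvalues_mem_spectrum_real i)
  rw [OrthonormalBasis.coe_toBasis, act_aeval (act_eigenvectorBasis hB i),
    Polynomial.eval_prod, Finset.prod_eq_zero hmem (by simp), zero_smul, act, map_zero,
    LinearMap.zero_apply]

theorem diam_lt_card_spectrum (hG : G.Connected) :
    G.diam < (Matrix.finite_real_spectrum (A := adjacencyMatrix G)).toFinset.card := by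
  have hmonic : ∀ μ ∈ (Matrix.finite_real_spectrum (A := adjacencyMatrix G)).toFinset,
      (Polynomial.X - Polynomial.C (μ : ℂ)).Monic := fun μ _ => Polynomial.monic_X_sub_C _
  have h := diam_lt_natDegree_of_aeval_eq_zero hG (Polynomial.monic_prod_of_monic _ _ hmonic)
    (aeval_prod_X_sub_C_spectrum (isHermitian_adjacencyMatrix G))
  rw [Polynomial.natDegree_prod_of_monic _ _ hmonic] at h
  simpa only [Polynomial.natDegree_X_sub_C, Finset.sum_const, smul_eq_mul, mul_one] using h

theorem linearIndependent_eigenprojection (B : Matrix X X ℂ) :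
    LinearIndependent ℂ fun θ : spectrum ℝ B => eigenprojection B θ := by
  refine Module.End.eigenvectors_linearIndependent' (LinearMap.mulLeft ℂ B)
    (fun θ : spectrum ℝ B => ((θ : ℝ) : ℂ))
    (Complex.ofReal_injective.comp Subtype.val_injective) _ fun θ => ⟨?_, ?_⟩
  · exact Module.End.mem_eigenspace_iff.mpr (mul_eigenprojection B θ)
  · exact eigenprojection_ne_zero θ.2

theorem card_spectrum_le (hG : IsDistanceRegular G) :
    (Matrix.finite_real_spectrum (A := adjacencyMatrix G)).toFinset.card ≤ G.diam + 1 := by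
  classical
  have hfin := Matrix.finite_real_spectrum (A := adjacencyMatrix G)
  have := hfin.fintype
  let distanceMatrices := (Finset.range (G.diam + 1)).image (distanceMatrix G)
  have hspan : Set.range (fun θ : spectrum ℝ (adjacencyMatrix G) =>
      eigenprojection (adjacencyMatrix G) θ) ⊆
        (Submodule.span ℂ (distanceMatrices : Set (Matrix X X ℂ)) : Set (Matrix X X ℂ)) := by
    rintro - ⟨θ, rfl⟩
    obtain ⟨q, hq⟩ := exists_eigenprojection_apply_eq_dist hG θ
    simp only [SetLike.mem_coe]
    rw [eq_sum_distanceMatrix hG.connected hq]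
    exact Submodule.sum_mem _ fun i hi =>
      Submodule.smul_mem _ _ (Submodule.subset_span (Finset.mem_image_of_mem _ hi))
  calc _ = Fintype.card (spectrum ℝ (adjacencyMatrix G)) := by
        rw [← Set.toFinset_card, hfin.toFinset_eq_toFinset]
    _ ≤ distanceMatrices.card := by
        simpa using linearIndependent_le_span' _
          (linearIndependent_eigenprojection (adjacencyMatrix G)) _ hspan
    _ ≤ G.diam + 1 := Finset.card_image_le.trans_eq (Finset.card_range _)

theorem card_spectrum (hG : IsDistanceRegular G) :
    (Matrix.finite_real_spectrum (A := adjacencyMatrix G)).toFinset.card = G.diam + 1 :=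
  le_antisymm (card_spectrum_le hG) (diam_lt_card_spectrum hG.connected)

theorem eigenvalue_strictAntiOn (hG : IsDistanceRegular G) :
    StrictAntiOn (eigenvalue G) (Set.Iic G.diam) := by
  intro i hi j hj hij
  have hlen : ((Matrix.finite_real_spectrum (A := adjacencyMatrix G)).toFinset.sort
      (· ≥ ·)).length = G.diam + 1 := by rw [Finset.length_sort, card_spectrum hG]
  rw [Set.mem_Iic] at hi hj
  rw [eigenvalue, eigenvalue, List.getD_eq_getElem _ _ (by omega),
    List.getD_eq_getElem _ _ (by omega)]
  exact List.pairwise_iff_getElem.mp (Finset.sortedGT_sort _).pairwise i j (by omega) (by omega) hij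

theorem image_eigenvalue (hG : IsDistanceRegular G) :
    eigenvalue G '' Set.Iic G.diam = spectrum ℝ (adjacencyMatrix G) := by
  have hlen : ((Matrix.finite_real_spectrum (A := adjacencyMatrix G)).toFinset.sort
      (· ≥ ·)).length = G.diam + 1 := by rw [Finset.length_sort, card_spectrum hG]
  ext θ
  rw [← Set.Finite.mem_toFinset (Matrix.finite_real_spectrum (A := adjacencyMatrix G)),
    ← Finset.mem_sort (· ≥ ·), List.mem_iff_getElem]
  constructor
  · rintro ⟨i, hi, rfl⟩
    have hi' : i < _ := (Nat.lt_succ_of_le hi).trans_eq hlen.symm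
    exact ⟨i, hi', (List.getD_eq_getElem _ _ hi').symm⟩
  · rintro ⟨i, hi, rfl⟩
    exact ⟨i, by simp only [Set.mem_Iic]; omega, List.getD_eq_getElem _ _ hi⟩

theorem neg_mem_spectrum (hbip : G.IsBipartite) {θ : ℝ}
    (h : θ ∈ spectrum ℝ (adjacencyMatrix G)) : -θ ∈ spectrum ℝ (adjacencyMatrix G) := by
  rw [mem_spectrum_iff_exists_act_eq_smul] at h ⊢
  obtain ⟨v, hv0, hv⟩ := h
  obtain ⟨color⟩ := exists_boolColoring hbip
  refine ⟨WithLp.toLp 2 fun y => if color y then v y else -v y, fun h0 => hv0 ?_, ?_⟩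
  · ext y
    have := congrArg (fun u : EuclideanSpace ℂ X => u y) h0
    simp only [PiLp.zero_apply] at this ⊢
    split_ifs at this
    · exact this
    · exact neg_eq_zero.mp this
  · ext y
    have hflip : ∀ z, adjacencyMatrix G y z * (if color z then v z else -v z) =
        (if color y then -1 else 1) * (adjacencyMatrix G y z * v z) := by
      intro z
      simp only [adjacencyMatrix, distanceMatrix, Matrix.of_apply]
      by_cases hyz : G.dist y z = 1
      · have := color.valid (SimpleGraph.dist_eq_one_iff_adj.mp hyz)
        cases hy : color y <;> cases hz : color z <;> simp_all
      · simp [hyz]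
    have hvy := congrArg (fun u : EuclideanSpace ℂ X => u y) hv
    simp only [act_apply, PiLp.smul_apply, smul_eq_mul] at hvy ⊢
    rw [Finset.sum_congr rfl fun z _ => hflip z, ← Finset.mul_sum, hvy]
    push_cast
    split_ifs <;> ring

theorem abs_mem_spectrum (hbip : G.IsBipartite) {θ : ℝ}
    (h : θ ∈ spectrum ℝ (adjacencyMatrix G)) : |θ| ∈ spectrum ℝ (adjacencyMatrix G) :=
  abs_by_cases (· ∈ spectrum ℝ (adjacencyMatrix G)) h (neg_mem_spectrum hbip h)

theorem valency_mem_spectrum (hG : IsDistanceRegular G) :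
    (valency G : ℝ) ∈ spectrum ℝ (adjacencyMatrix G) := by
  obtain ⟨x⟩ := hG.connected.nonempty
  refine mem_spectrum_iff_exists_act_eq_smul.mpr ⟨WithLp.toLp 2 fun _ => 1, fun h => ?_, ?_⟩
  · simpa using congrArg (fun u : EuclideanSpace ℂ X => u x) h
  · ext y
    simp [act_apply, sum_adjacencyMatrix_apply hG]

theorem abs_le_valency_of_mem_spectrum (hG : IsDistanceRegular G) {θ : ℝ}
    (h : θ ∈ spectrum ℝ (adjacencyMatrix G)) : |θ| ≤ valency G := by
  have hev : Module.End.HasEigenvalue (Matrix.toLin' (adjacencyMatrix G)) (θ : ℂ) := by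
    rw [Module.End.hasEigenvalue_iff_mem_spectrum, Matrix.spectrum_toLin']
    exact (spectrum.algebraMap_mem_iff ℂ).mpr h
  obtain ⟨y, hy⟩ := eigenvalue_mem_ball hev
  have hdiag : adjacencyMatrix G y y = 0 := by simp [adjacencyMatrix, distanceMatrix]
  have hnorm : ∀ z, ‖adjacencyMatrix G y z‖ = (adjacencyMatrix G y z).re := fun z => by
    simp only [adjacencyMatrix, distanceMatrix, Matrix.of_apply]
    split_ifs <;> simp
  rw [hdiag, mem_closedBall_zero_iff, Complex.norm_real, Real.norm_eq_abs] at hy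
  refine hy.trans ((Finset.sum_le_univ_sum_of_nonneg fun _ => norm_nonneg _).trans_eq ?_)
  simp only [hnorm, ← Complex.re_sum, sum_adjacencyMatrix_apply hG, Complex.natCast_re]

end Spectrum

section Eigenvalue

variable {X : Type*} [Fintype X] [DecidableEq X] {G : SimpleGraph X}

theorem eigenvalue_mem_spectrum (hG : IsDistanceRegular G) {i : ℕ} (hi : i ≤ G.diam) :
    eigenvalue G i ∈ spectrum ℝ (adjacencyMatrix G) :=
  image_eigenvalue hG ▸ Set.mem_image_of_mem _ hi

theorem exists_eigenvalue_eq (hG : IsDistanceRegular G) {θ : ℝ}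
    (hθ : θ ∈ spectrum ℝ (adjacencyMatrix G)) : ∃ i ≤ G.diam, eigenvalue G i = θ :=
  (Set.ext_iff.mp (image_eigenvalue hG) θ).mpr hθ

theorem eigenvalue_zero (hG : IsDistanceRegular G) : eigenvalue G 0 = valency G := by
  obtain ⟨i, hi, hik⟩ := exists_eigenvalue_eq hG (valency_mem_spectrum hG)
  refine le_antisymm ?_ (hik ▸ (eigenvalue_strictAntiOn hG).antitoneOn
    (Nat.zero_le _) hi (Nat.zero_le _))
  exact (le_abs_self _).trans
    (abs_le_valency_of_mem_spectrum hG (eigenvalue_mem_spectrum hG (Nat.zero_le _)))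

theorem eigenvalue_diam_sub (hG : IsDistanceRegular G) (hbip : G.IsBipartite) {i : ℕ}
    (hi : i ≤ G.diam) : eigenvalue G (G.diam - i) = -eigenvalue G i := by
  have hanti : StrictAnti fun i : Fin (G.diam + 1) => eigenvalue G i := fun i j hij =>
    eigenvalue_strictAntiOn hG (Nat.lt_succ_iff.mp i.2) (Nat.lt_succ_iff.mp j.2) hij
  have hanti' : StrictAnti fun i : Fin (G.diam + 1) => -eigenvalue G i.rev :=
    fun i j hij => neg_lt_neg (hanti (Fin.rev_lt_rev.mpr hij))
  have hrange : ∀ θ, θ ∈ Set.range (fun i : Fin (G.diam + 1) => eigenvalue G i) ↔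
      θ ∈ spectrum ℝ (adjacencyMatrix G) := fun θ =>
    ⟨by rintro ⟨i, rfl⟩; exact eigenvalue_mem_spectrum hG (Nat.lt_succ_iff.mp i.2),
      fun hθ => let ⟨i, hi, h⟩ := exists_eigenvalue_eq hG hθ; ⟨⟨i, Nat.lt_succ_of_le hi⟩, h⟩⟩
  have hrange' : ∀ θ, θ ∈ Set.range (fun i : Fin (G.diam + 1) => -eigenvalue G i.rev) ↔
      θ ∈ spectrum ℝ (adjacencyMatrix G) := fun θ => by
    refine ⟨?_, fun hθ => ?_⟩
    · rintro ⟨i, rfl⟩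
      exact neg_mem_spectrum hbip (eigenvalue_mem_spectrum hG (Nat.lt_succ_iff.mp i.rev.2))
    · obtain ⟨i, hi, hiθ⟩ := exists_eigenvalue_eq hG (neg_mem_spectrum hbip hθ)
      exact ⟨Fin.rev ⟨i, Nat.lt_succ_of_le hi⟩, by simp only [Fin.rev_rev, hiθ, neg_neg]⟩
  -- Both enumerations of the spectrum are decreasing, so they agree.
  have hfun := (hanti.range_inj hanti').mp (Set.ext fun θ => (hrange θ).trans (hrange' θ).symm)
  have hrev := congrFun hfun ⟨i, Nat.lt_succ_of_le hi⟩
  simp only [Fin.val_rev, Nat.add_sub_add_right] at hrev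
  rw [hrev, neg_neg]

theorem sq_le_eigenvalue_one_sq (hG : IsDistanceRegular G) (hbip : G.IsBipartite) {θ : ℝ}
    (hθ : θ ∈ spectrum ℝ (adjacencyMatrix G)) (hθk : θ ^ 2 ≠ (valency G : ℝ) ^ 2) :
    θ ^ 2 ≤ eigenvalue G 1 ^ 2 := by
  obtain ⟨i, hi, hiθ⟩ := exists_eigenvalue_eq hG (abs_mem_spectrum hbip hθ)
  have hi0 : i ≠ 0 := by
    rintro rfl
    rw [← sq_abs, ← hiθ, eigenvalue_zero hG] at hθk
    exact hθk rfl
  have hi1 : 1 ≤ i := Nat.one_le_iff_ne_zero.mpr hi0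
  rw [← sq_abs, ← hiθ]
  exact pow_le_pow_left₀ (hiθ ▸ abs_nonneg θ)
    ((eigenvalue_strictAntiOn hG).antitoneOn (hi1.trans hi) hi hi1) 2

theorem eigenvalue_half_sq_le (hG : IsDistanceRegular G) (hbip : G.IsBipartite)
    (hodd : Odd G.diam) {θ : ℝ} (hθ : θ ∈ spectrum ℝ (adjacencyMatrix G)) :
    eigenvalue G (G.diam / 2) ^ 2 ≤ θ ^ 2 := by
  obtain ⟨d, hd⟩ := hodd
  obtain ⟨i, hi, hiθ⟩ := exists_eigenvalue_eq hG (abs_mem_spectrum hbip hθ)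
  have hanti := (eigenvalue_strictAntiOn hG).antitoneOn
  have hneg : eigenvalue G (d + 1) = -eigenvalue G d := by
    rw [← eigenvalue_diam_sub hG hbip (by omega)]
    congr 1
    omega
  have hpos : 0 < eigenvalue G d := by
    have := eigenvalue_strictAntiOn hG (show d ≤ G.diam by omega)
      (show d + 1 ≤ G.diam by omega) d.lt_succ_self
    linarith
  have hid : i ≤ d := by
    by_contra! hdi
    have := hanti (show d + 1 ≤ G.diam by omega) hi hdi
    have := abs_nonneg θ
    linarith
  rw [show G.diam / 2 = d by omega, ← sq_abs θ, ← hiθ]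
  exact pow_le_pow_left₀ hpos.le (hanti hi (show d ≤ G.diam by omega) hid) 2

theorem apply_eq_apply_of_act_adjacencyMatrix_eq_smul (hG : IsDistanceRegular G)
    (hbip : G.IsBipartite) {θ : ℝ} (hθ : θ ^ 2 = (valency G : ℝ) ^ 2) {w : EuclideanSpace ℂ X}
    (hw : act (adjacencyMatrix G) w = (θ : ℂ) • w) {u v : X} (huv : Even (G.dist u v)) :
    w u = w v := by
  obtain ⟨q, hq⟩ := exists_eigenprojection_apply_eq_dist hG θ
  have hcos := isCosineSequence_of_eigenprojection hG hbip hq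
  rw [← act_eigenprojection_eq_self hw, act_apply, act_apply]
  refine Finset.sum_congr rfl fun z _ => ?_
  rw [hq, hq, hcos.apply_eq_apply_of_even_iff hG hbip (by exact_mod_cast hθ)
    (dist_le_diam_of_connected hG.connected u z) (dist_le_diam_of_connected hG.connected v z)
    (even_dist_iff_of_even_dist hG.connected hbip huv z)]

theorem inner_act_adjacencyMatrix_single (hG : IsDistanceRegular G) (u v : X) :
    inner ℂ (act (adjacencyMatrix G) (EuclideanSpace.single u 1))
        (act (adjacencyMatrix G) (EuclideanSpace.single v 1)) =
      (intersectionNumber G (G.dist u v) 1 1 : ℂ) := by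
  rw [act_isSymmetric (isHermitian_adjacencyMatrix G), ← act_mul,
    EuclideanSpace.inner_single_left, map_one, one_mul, act_single]
  exact distanceMatrix_mul_apply hG 1 1 u v

theorem norm_act_adjacencyMatrix_single_sq (hG : IsDistanceRegular G) (u : X) :
    ‖act (adjacencyMatrix G) (EuclideanSpace.single u 1)‖ ^ 2 = valency G := by
  rw [← inner_self_eq_norm_sq (𝕜 := ℂ), inner_act_adjacencyMatrix_single hG,
    SimpleGraph.dist_self]
  exact Complex.natCast_re _

theorem valency_le_eigenvalue_one_sq (hG : IsDistanceRegular G) (hbip : G.IsBipartite)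
    (hD : 4 ≤ G.diam) : (valency G : ℝ) ≤ eigenvalue G 1 ^ 2 := by
  obtain ⟨γ, hγ⟩ := exists_geodesic hG.connected
  have h04 : G.dist (γ 0) (γ 4) = 4 := hγ 0 4 (by omega) hD
  have hne : γ 0 ≠ γ 4 := fun h => by simp [h] at h04
  set f : EuclideanSpace ℂ X := EuclideanSpace.single (γ 0) 1 - EuclideanSpace.single (γ 4) 1
    with hf
  have hnorm : ‖f‖ ^ 2 = 2 := by
    rw [hf, norm_sub_sq (𝕜 := ℂ)]
    norm_num [EuclideanSpace.inner_single_left, hne]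
  have hnorm_act : ‖act (adjacencyMatrix G) f‖ ^ 2 = 2 * valency G := by
    rw [hf, map_sub, norm_sub_sq (𝕜 := ℂ), inner_act_adjacencyMatrix_single hG, h04,
      intersectionNumber_eq_zero hG.connected (by norm_num)]
    simp only [norm_act_adjacencyMatrix_single_sq hG, Nat.cast_zero, map_zero]
    ring
  set hA := isHermitian_adjacencyMatrix G
  -- `f` is orthogonal to the eigenvectors for `k` and `-k`.
  have hterm : ∀ i, hA.eigenvalues i ^ 2 * ‖inner ℂ (hA.eigenvectorBasis i) f‖ ^ 2 ≤
      eigenvalue G 1 ^ 2 * ‖inner ℂ (hA.eigenvectorBasis i) f‖ ^ 2 := by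
    intro i
    by_cases hk : hA.eigenvalues i ^ 2 = (valency G : ℝ) ^ 2
    · have heq := apply_eq_apply_of_act_adjacencyMatrix_eq_smul hG hbip hk
        (act_eigenvectorBasis hA i) (u := γ 0) (v := γ 4) (by rw [h04]; decide)
      simp [hf, EuclideanSpace.inner_single_right, heq]
    · exact mul_le_mul_of_nonneg_right
        (sq_le_eigenvalue_one_sq hG hbip (hA.eigenvalues_mem_spectrum_real i) hk) (sq_nonneg _)
  have hle := Finset.sum_le_sum fun i (_ : i ∈ Finset.univ) => hterm i
  rw [← norm_act_sq hA, ← Finset.mul_sum, hA.eigenvectorBasis.sum_sq_norm_inner_right, hnorm,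
    hnorm_act] at hle
  linarith

theorem three_mul_eigenvalue_half_sq_le (hG : IsDistanceRegular G) (hbip : G.IsBipartite)
    (hD : 4 ≤ G.diam) (hodd : Odd G.diam) :
    3 * eigenvalue G (G.diam / 2) ^ 2 ≤ 3 * (valency G : ℝ) - 4 * c G 2 := by
  obtain ⟨γ, hγ⟩ := exists_geodesic hG.connected
  have h02 : G.dist (γ 0) (γ 2) = 2 := hγ 0 2 (by omega) (by omega)
  have h24 : G.dist (γ 2) (γ 4) = 2 := hγ 2 4 (by omega) hD
  have h04 : G.dist (γ 0) (γ 4) = 4 := hγ 0 4 (by omega) hD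
  have hne02 : γ 0 ≠ γ 2 := fun h => by simp [h] at h02
  have hne24 : γ 2 ≠ γ 4 := fun h => by simp [h] at h24
  have hne04 : γ 0 ≠ γ 4 := fun h => by simp [h] at h04
  set f : EuclideanSpace ℂ X := EuclideanSpace.single (γ 0) 1 - EuclideanSpace.single (γ 2) 1 +
    EuclideanSpace.single (γ 4) 1 with hf
  have hnorm : ‖f‖ ^ 2 = 3 := by
    rw [hf, norm_add_sq (𝕜 := ℂ), norm_sub_sq (𝕜 := ℂ)]
    norm_num [EuclideanSpace.inner_single_left, inner_sub_left, hne02, hne24, hne04]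
  have hnorm_act : ‖act (adjacencyMatrix G) f‖ ^ 2 = 3 * valency G - 4 * c G 2 := by
    rw [hf, map_add, map_sub, norm_add_sq (𝕜 := ℂ), norm_sub_sq (𝕜 := ℂ), inner_sub_left]
    simp only [norm_act_adjacencyMatrix_single_sq hG, inner_act_adjacencyMatrix_single hG, h02,
      h24, h04, intersectionNumber_eq_zero hG.connected (show 1 + 1 < 4 by norm_num),
      Nat.cast_zero, zero_sub, map_neg]
    change (valency G : ℝ) - 2 * (c G 2 : ℂ).re + valency G + 2 * -(c G 2 : ℂ).re + valency G = _
    rw [Complex.natCast_re]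
    ring
  set hA := isHermitian_adjacencyMatrix G
  have hle := Finset.sum_le_sum fun i (_ : i ∈ Finset.univ) => mul_le_mul_of_nonneg_right
    (eigenvalue_half_sq_le hG hbip hodd (hA.eigenvalues_mem_spectrum_real i))
    (sq_nonneg ‖inner ℂ (hA.eigenvectorBasis i) f‖)
  rw [← norm_act_sq hA, ← Finset.mul_sum, hA.eigenvectorBasis.sum_sq_norm_inner_right, hnorm,
    hnorm_act] at hle
  linarith

theorem eigenvalue_sq_ne_b (hG : IsDistanceRegular G) (hbip : G.IsBipartite) (hD : 4 ≤ G.diam)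
    {n : ℕ} (hn : n = 1 ∨ (Odd G.diam ∧ n = G.diam / 2)) : eigenvalue G n ^ 2 ≠ b G 2 := by
  have hcb : (c G 2 : ℝ) + b G 2 = valency G := by
    exact_mod_cast c_add_b hG hbip (i := 2) (by omega)
  have hc : (0 : ℝ) < c G 2 := by exact_mod_cast c_pos hG (i := 2) (by omega) (by omega)
  rcases hn with rfl | ⟨hodd, rfl⟩
  · have := valency_le_eigenvalue_one_sq hG hbip hD
    exact ne_of_gt (by linarith)
  · have := three_mul_eigenvalue_half_sq_le hG hbip hD hodd
    exact ne_of_lt (by linarith)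

end Eigenvalue

section Tilde

variable {X : Type*} [Fintype X] {G : SimpleGraph X}

theorem b_mul_b_add_one_add_tilde_mul {τ : ℝ} (hτ : τ ^ 2 ≠ b G 2) (θ : ℝ) :
    (b G 2 * b G 3 + (1 + tilde G τ) * (θ ^ 2 - b G 2)) * (τ ^ 2 - b G 2) =
      b G 2 * b G 3 * (τ ^ 2 - θ ^ 2) := by
  have := sub_ne_zero.mpr hτ
  rw [tilde]
  field_simp
  ring

theorem card_mul_valency_mul_b_one_ne_zero (hG : IsDistanceRegular G) (hD : 2 ≤ G.diam) :
    (Fintype.card X : ℝ) * valency G * b G 1 ≠ 0 := by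
  have := hG.connected.nonempty
  have hk : valency G ≠ 0 := (b_pos hG (by omega)).ne'
  have hb : b G 1 ≠ 0 := (b_pos hG (by omega)).ne'
  exact_mod_cast mul_ne_zero (mul_ne_zero Fintype.card_ne_zero hk) hb

end Tilde

section SecondSubconstituent

variable {X : Type*} [Fintype X] [DecidableEq X] {G : SimpleGraph X} {x : X}
  {v : EuclideanSpace ℂ X}

theorem act_dualIdempotent_apply (G : SimpleGraph X) (x : X) (i : ℕ) (v : EuclideanSpace ℂ X)
    (y : X) : act (dualIdempotent G x i) v y = if G.dist x y = i then v y else 0 := by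
  simp [act, Matrix.toLpLin_apply, dualIdempotent, Matrix.mulVec_diagonal]

theorem apply_eq_zero_of_act_dualIdempotent {i : ℕ} (hv : act (dualIdempotent G x i) v = v)
    {y : X} (hy : G.dist x y ≠ i) : v y = 0 := by
  rw [← hv, act_dualIdempotent_apply, if_neg hy]

theorem act_dualIdempotent_of_mem_dualComponent {i : ℕ}
    {W : Submodule ℂ (EuclideanSpace ℂ X)} (hv : v ∈ dualComponent G x i W) :
    act (dualIdempotent G x i) v = v := by
  obtain ⟨w, -, rfl⟩ := hv
  ext y
  simp only [act_dualIdempotent_apply]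
  split_ifs <;> rfl

theorem dualComponent_le {i : ℕ} {W : Submodule ℂ (EuclideanSpace ℂ X)}
    (hW : IsTModule G x W) : dualComponent G x i W ≤ W := by
  rintro _ ⟨w, hw, rfl⟩
  exact hW _ ((le_sup_right : dualBoseMesnerAlgebra G x ≤ _)
    (Algebra.subset_adjoin (Set.mem_range_self i))) w hw

theorem apply_base_eq_zero_of_endpoint_ne_zero {W : Submodule ℂ (EuclideanSpace ℂ X)}
    (hend : endpoint G x W ≠ 0) {w : EuclideanSpace ℂ X} (hw : w ∈ W) : w x = 0 := by
  have hbot : dualComponent G x 0 W = ⊥ := by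
    by_contra h
    exact hend (Nat.le_zero.mp (Nat.sInf_le ⟨Nat.zero_le _, h⟩))
  have hmem : act (dualIdempotent G x 0) w ∈ dualComponent G x 0 W :=
    Submodule.mem_map_of_mem hw
  have hzero : act (dualIdempotent G x 0) w = 0 := by rwa [hbot, Submodule.mem_bot] at hmem
  simpa [act_dualIdempotent_apply] using congrArg (· x) hzero

theorem act_adjacencyMatrix_sq_apply_base (hG : IsDistanceRegular G)
    (hv : act (dualIdempotent G x 2) v = v) :
    act (adjacencyMatrix G * adjacencyMatrix G) v x = c G 2 * ∑ y, v y := by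
  rw [act_apply, Finset.mul_sum]
  refine Finset.sum_congr rfl fun y _ => ?_
  by_cases hy : G.dist x y = 2
  · rw [adjacencyMatrix, distanceMatrix_mul_apply hG, hy]
    rfl
  · rw [apply_eq_zero_of_act_dualIdempotent hv hy, mul_zero, mul_zero]

theorem sum_eq_zero_of_mem_dualComponent (hG : IsDistanceRegular G) (hD : 2 ≤ G.diam)
    {W : Submodule ℂ (EuclideanSpace ℂ X)} (hW : IsTModule G x W) (hend : endpoint G x W ≠ 0)
    (hv : v ∈ dualComponent G x 2 W) : ∑ y, v y = 0 := by
  have hA : adjacencyMatrix G ∈ subconstituentAlgebra G x :=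
    (le_sup_left : boseMesnerAlgebra G ≤ _) (Algebra.self_mem_adjoin_singleton _ _)
  have hzero := apply_base_eq_zero_of_endpoint_ne_zero hend
    (hW _ (mul_mem hA hA) v (dualComponent_le hW hv))
  rw [act_adjacencyMatrix_sq_apply_base hG (act_dualIdempotent_of_mem_dualComponent hv)] at hzero
  exact (mul_eq_zero.mp hzero).resolve_left
    (Nat.cast_ne_zero.mpr (c_pos hG (by norm_num) hD).ne')

/-- `v` is a local eigenvector for `η` with respect to the base vertex `x`: a vector of `E*_2 V`,
possibly zero, that is orthogonal to the all-ones vector and on which `E*_2 A_2 E*_2` acts as `η`.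
This is what remains of a thin irreducible module `W` of endpoint 2 and local eigenvalue `η` in the
computation of `‖E v‖` for `v` in `E*_2 W`. -/
structure IsLocalEigenvector (G : SimpleGraph X) (x : X) (η : ℂ) (v : EuclideanSpace ℂ X) :
    Prop where
  act_dualIdempotent : act (dualIdempotent G x 2) v = v
  sum_eq_zero : ∑ y, v y = 0
  act_eq_smul :
    act (dualIdempotent G x 2 * distanceMatrix G 2 * dualIdempotent G x 2) v = η • v

theorem isLocalEigenvector_of_mem_dualComponent (hG : IsDistanceRegular G) (hD : 2 ≤ G.diam)
    {W : Submodule ℂ (EuclideanSpace ℂ X)} (hW : IsTModule G x W) (hend : endpoint G x W ≠ 0)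
    {η : ℝ} (hloc : HasLocalEigenvalue G x W η) (hv : v ∈ dualComponent G x 2 W) :
    IsLocalEigenvector G x η v :=
  ⟨act_dualIdempotent_of_mem_dualComponent hv,
    sum_eq_zero_of_mem_dualComponent hG hD hW hend hv, hloc v hv⟩

namespace IsLocalEigenvector

variable {η : ℂ}

theorem act_distanceMatrix_apply (hv : IsLocalEigenvector G x η v) {y : X}
    (hy : G.dist x y = 2) : act (distanceMatrix G 2) v y = η * v y := by
  have hloc := hv.act_eq_smul
  rw [act_mul, act_mul, hv.act_dualIdempotent] at hloc
  simpa [act_dualIdempotent_apply, hy] using congrArg (· y) hloc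

theorem apply_eq_zero (hv : IsLocalEigenvector G x η v) {y : X} (hy : G.dist x y ≠ 2) :
    v y = 0 :=
  apply_eq_zero_of_act_dualIdempotent hv.act_dualIdempotent hy

theorem act_apply_of_dist (hv : IsLocalEigenvector G x η v) (hG : G.Connected)
    (hbip : G.IsBipartite) {B : Matrix X X ℂ} {q : ℕ → ℂ} (hB : ∀ y z, B y z = q (G.dist y z))
    {y : X} (hy : G.dist x y = 2) : act B v y = (q 0 + η * q 2 - (1 + η) * q 4) * v y := by
  have hterm : ∀ z, B y z * v z = (q 0 - q 4) * (if y = z then v z else 0) +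
      (q 2 - q 4) * (distanceMatrix G 2 y z * v z) + q 4 * v z := by
    intro z
    by_cases hz : G.dist x z = 2
    · have hyz : y = z ↔ G.dist y z = 0 := hG.dist_eq_zero_iff.symm
      simp only [hB, distanceMatrix, Matrix.of_apply, hyz]
      rcases dist_eq_zero_or_two_or_four hG hbip hy hz with h | h | h <;> norm_num [h] <;> ring
    · simp [hv.apply_eq_zero hz]
  have hη := hv.act_distanceMatrix_apply hy
  rw [act_apply] at hη
  rw [act_apply, Finset.sum_congr rfl fun z _ => hterm z, Finset.sum_add_distrib,
    Finset.sum_add_distrib, ← Finset.mul_sum, ← Finset.mul_sum, ← Finset.mul_sum, hη,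
    hv.sum_eq_zero, Finset.sum_ite_eq, if_pos (Finset.mem_univ y)]
  ring

theorem inner_act_of_dist (hv : IsLocalEigenvector G x η v) (hG : G.Connected)
    (hbip : G.IsBipartite) {B : Matrix X X ℂ} {q : ℕ → ℂ}
    (hB : ∀ y z, B y z = q (G.dist y z)) :
    inner ℂ v (act B v) = (q 0 + η * q 2 - (1 + η) * q 4) * (‖v‖ : ℂ) ^ 2 := by
  have hself : inner ℂ v v = (‖v‖ : ℂ) ^ 2 := inner_self_eq_norm_sq_to_K v
  rw [← hself, ← inner_smul_right, PiLp.inner_apply, PiLp.inner_apply]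
  refine Finset.sum_congr rfl fun y _ => ?_
  by_cases hy : G.dist x y = 2
  · rw [hv.act_apply_of_dist hG hbip hB hy, PiLp.smul_apply, smul_eq_mul]
  · simp [hv.apply_eq_zero hy]

theorem norm_act_eigenprojection_sq {η : ℝ} (hv : IsLocalEigenvector G x η v)
    (hG : IsDistanceRegular G) (hbip : G.IsBipartite) (hD : 3 ≤ G.diam) (θ : ℝ) :
    (Fintype.card X : ℝ) * valency G * b G 1 * (b G 2 * b G 3) *
        ‖act (eigenprojection (adjacencyMatrix G) θ) v‖ ^ 2 =
      (eigenprojection (adjacencyMatrix G) θ).rank * ((valency G : ℝ) ^ 2 - θ ^ 2) *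
        (b G 2 * b G 3 + (1 + η) * (θ ^ 2 - b G 2)) * ‖v‖ ^ 2 := by
  obtain ⟨q, hq⟩ := exists_eigenprojection_apply_eq_dist hG θ
  have hinner := DRG.norm_act_eigenprojection_sq (adjacencyMatrix G) θ v
  rw [hv.inner_act_of_dist hG.connected hbip hq] at hinner
  have hcos := (isCosineSequence_of_eigenprojection hG hbip
    hq).apply_zero_add_apply_two_sub_apply_four hG hbip hD η
  have hrank := card_mul_apply_zero_of_eigenprojection hq
  apply Complex.ofReal_injective
  push_cast at hinner ⊢
  rw [hinner, ← hrank]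
  linear_combination Fintype.card X * (‖v‖ : ℂ) ^ 2 * hcos

theorem norm_act_eigenprojection_sq_of_tilde {τ : ℝ}
    (hv : IsLocalEigenvector G x (tilde G τ) v) (hG : IsDistanceRegular G)
    (hbip : G.IsBipartite) (hD : 4 ≤ G.diam) (hτ : τ ^ 2 ≠ b G 2) (θ : ℝ) :
    ‖act (eigenprojection (adjacencyMatrix G) θ) v‖ ^ 2 =
      (eigenprojection (adjacencyMatrix G) θ).rank * (θ ^ 2 - (valency G : ℝ) ^ 2) *
          (θ ^ 2 - τ ^ 2) /
        ((Fintype.card X : ℝ) * valency G * b G 1 * (τ ^ 2 - b G 2)) * ‖v‖ ^ 2 := by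
  have hb : (b G 2 * b G 3 : ℝ) ≠ 0 := by
    exact_mod_cast mul_ne_zero (b_pos hG (by omega)).ne' (b_pos hG (by omega)).ne'
  rw [div_mul_eq_mul_div, eq_div_iff (mul_ne_zero
    (card_mul_valency_mul_b_one_ne_zero hG (by omega)) (sub_ne_zero.mpr hτ))]
  refine mul_left_cancel₀ hb ?_
  linear_combination
    (τ ^ 2 - b G 2) * hv.norm_act_eigenprojection_sq hG hbip (by omega) θ +
    (eigenprojection (adjacencyMatrix G) θ).rank * ((valency G : ℝ) ^ 2 - θ ^ 2) * ‖v‖ ^ 2 *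
      b_mul_b_add_one_add_tilde_mul hτ θ

end IsLocalEigenvector

end SecondSubconstituent

end DRG

theorem mainTheorem7_general {X : Type*} [Fintype X] [DecidableEq X] {G : SimpleGraph X}
    (hG : DRG.IsDistanceRegular G) (hbip : G.IsBipartite) (hD : 4 ≤ G.diam)
    {x : X} {n : ℕ} (hn : n = 1 ∨ (Odd G.diam ∧ n = G.diam / 2)) {v : EuclideanSpace ℂ X}
    (hv : DRG.IsLocalEigenvector G x (DRG.tilde G (DRG.eigenvalue G n)) v) :
    (∀ i ≤ G.diam, ∀ j ≤ G.diam, i ≠ j →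
      inner ℂ (DRG.act (DRG.primitiveIdempotent G i) v)
        (DRG.act (DRG.primitiveIdempotent G j) v) = 0) ∧
    (Fintype.card X : ℝ) * DRG.valency G * DRG.b G 1 *
      (DRG.eigenvalue G n ^ 2 - DRG.b G 2) ≠ 0 ∧
    (∀ i ≤ G.diam,
      ‖DRG.act (DRG.primitiveIdempotent G i) v‖ ^ 2 =
        (DRG.multiplicity G i : ℝ) *
            (DRG.eigenvalue G i ^ 2 - (DRG.valency G : ℝ) ^ 2) *
            (DRG.eigenvalue G i ^ 2 - DRG.eigenvalue G n ^ 2) /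
          ((Fintype.card X : ℝ) * DRG.valency G * DRG.b G 1 *
            (DRG.eigenvalue G n ^ 2 - DRG.b G 2)) * ‖v‖ ^ 2) := by
  have hne : DRG.eigenvalue G n ^ 2 ≠ DRG.b G 2 := DRG.eigenvalue_sq_ne_b hG hbip hD hn
  refine ⟨fun i hi j hj hij => ?_,
    mul_ne_zero (DRG.card_mul_valency_mul_b_one_ne_zero hG (by omega)) (sub_ne_zero.mpr hne),
    fun i _ => hv.norm_act_eigenprojection_sq_of_tilde hG hbip hD hne (DRG.eigenvalue G i)⟩
  exact DRG.inner_eq_zero_of_act_eq_smul (DRG.isHermitian_adjacencyMatrix G)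
    (fun h => hij ((DRG.eigenvalue_strictAntiOn hG).injOn hi hj h))
    (DRG.act_act_eigenprojection _ _ v) (DRG.act_act_eigenprojection _ _ v)

theorem mainTheorem7 {X : Type*} [Fintype X] [DecidableEq X] (G : SimpleGraph X)
    (hG : DRG.IsDistanceRegular G) (hbip : G.IsBipartite)
    (hD : 4 ≤ G.diam) (hk : 3 ≤ DRG.valency G)
    (x : X) (n : ℕ) (hn : n = 1 ∨ (Odd G.diam ∧ n = G.diam / 2))
    (W : Submodule ℂ (EuclideanSpace ℂ X))
    (hW : DRG.IsIrreducibleTModule G x W) (hthin : DRG.IsThin G x W)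
    (hend : DRG.endpoint G x W = 2)
    (hloc : DRG.HasLocalEigenvalue G x W (DRG.tilde G (DRG.eigenvalue G n)))
    (v : EuclideanSpace ℂ X) (hv : v ∈ DRG.dualComponent G x 2 W) (hv0 : v ≠ 0) :
    (∀ i ∈ Finset.Icc 1 (G.diam - 1), i ≠ n → i ≠ G.diam - n →
      ∀ j ∈ Finset.Icc 1 (G.diam - 1), j ≠ n → j ≠ G.diam - n → i ≠ j →
        inner ℂ (DRG.act (DRG.primitiveIdempotent G i) v)
          (DRG.act (DRG.primitiveIdempotent G j) v) = 0) ∧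
    (Fintype.card X : ℝ) * DRG.valency G * DRG.b G 1 *
      (DRG.eigenvalue G n ^ 2 - DRG.b G 2) ≠ 0 ∧
    (∀ i ∈ Finset.Icc 1 (G.diam - 1), i ≠ n → i ≠ G.diam - n →
      ‖DRG.act (DRG.primitiveIdempotent G i) v‖ ^ 2 =
        (DRG.multiplicity G i : ℝ) *
            (DRG.eigenvalue G i ^ 2 - (DRG.valency G : ℝ) ^ 2) *
            (DRG.eigenvalue G i ^ 2 - DRG.eigenvalue G n ^ 2) /
          ((Fintype.card X : ℝ) * DRG.valency G * DRG.b G 1 *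
            (DRG.eigenvalue G n ^ 2 - DRG.b G 2)) * ‖v‖ ^ 2) := by
  obtain ⟨horth, hden, hnorm⟩ := mainTheorem7_general hG hbip hD hn
    (DRG.isLocalEigenvector_of_mem_dualComponent hG (by omega) hW.isTModule (by omega) hloc hv)
  have hle : ∀ i ∈ Finset.Icc 1 (G.diam - 1), i ≤ G.diam := fun i hi =>
    (Finset.mem_Icc.mp hi).2.trans (Nat.sub_le _ _)
  exact ⟨fun i hi _ _ j hj _ _ => horth i (hle i hi) j (hle j hj), hden,
    fun i hi _ _ => hnorm i (hle i hi)⟩
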